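/- Let $K$ be a field that is complete with respect to a discrete valuation $v$, with valuation ring $\mathcal{O}$, maximal ideal $\mathfrak{m}$ and residue field $k=\mathcal{O}/\mathfrak{m}$ of characteristic $p\ge 0$ ($k$ is not assumed finite or perfect). Let $\ell\ge 2$ be an integer not divisible by $p$, let $c\in K^\times$ and $a\in K$ satisfy $v(c)\ge 0$ and $v(a)\ge 0$, and let $f(z)=z^\ell-c$; write also $f$ for the map induced on $k$. Fix an algebraic closure $\overline{K}$ of $K$, extend $v$ to $\overline{K}$, and for $n\ge 0$ let $K_n\subseteq\overline{K}$ be the field generated over $K$ by all solutions $z\in\overline{K}$ of $f^n(z)=a$, where $f^n$ is the $n$-th iterate of $f$. Let $K_\infty=\bigcup_{n\ge 0}K_n$. For an algebraic extension $L/K$, the ramification index is the (possibly infinite) index $(v(L^\times):v(K^\times))$; $L/K$ is infinitely ramified if this index is infinite, and unramified if it is $1$ and the extension of residue fields is separable. The forward orbit of $x$ under a map $g$ is $\{g^n(x): n\ge 0\}$; $x$ is strictly preperiodic if some iterate $g^n(x)$ is periodic but $x$ is not; $x$ and $y$ are in a single cycle of $g$ if $x$ is periodic and $y$ is in the forward orbit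 of $x$. Then: (a) If $a \bmod \mathfrak{m}$ is not in the forward orbit of $0\bmod\mathfrak{m}$ under $f$, then $K_\infty/K$ is unramified. (b) If $0 \bmod \mathfrak{m}$ is strictly preperiodic under $f$, then the ramification index of $K_\infty/K$ is finite and divides $\ell$. (c) If $0$ and $a$ are in a single cycle of $f$ (acting on $K$), then $K_\infty/K$ is unramified. (d) If $0\bmod\mathfrak{m}$ and $a\bmod\mathfrak{m}$ are in a single cycle of $f$ acting on $k$, but $0$ and $a$ are not both in a single cycle of $f$ acting on $K$, then $K_\infty/K$ is infinitely ramified. -/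

import Mathlib

open scoped NNReal

namespace Arboreal

section ValuedExtensions

variable (K : Type*) [NontriviallyNormedField K] [IsUltrametricDist K]

/-- The valuation of the nonarchimedean field `K`, written multiplicatively: `x ↦ ‖x‖`.  In the
additive notation this is `v = - log ‖x‖`, so `v(x) ≥ 0` reads `baseValuation K x ≤ 1`. -/
noncomputable abbrev baseValuation : Valuation K ℝ≥0 := NormedField.valuation

/-- The valuation ring of `K`. -/
noncomputable abbrev integers : ValuationSubring K := (baseValuation K).valuationSubring

/-- The residue field of `K`. -/
noncomputable abbrev residueField : Type _ := IsLocalRing.ResidueField (integers K)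

variable [CompleteSpace K] (L : Type*) [Field L] [Algebra K L] [Algebra.IsAlgebraic K L]

/-- The unique extension of the valuation of the complete field `K` to an algebraic extension `L`
(finite or infinite). -/
noncomputable def extendedValuation : Valuation L ℝ≥0 where
  toFun x := ⟨spectralNorm K L x, spectralNorm_nonneg x⟩
  map_zero' := Subtype.ext spectralNorm_zero
  map_one' := Subtype.ext spectralNorm_one
  map_mul' x y := Subtype.ext (spectralAlgNorm_mul x y)
  map_add_le_max' x y := isNonarchimedean_spectralNorm x y

instance hasExtension : (baseValuation K).HasExtension (extendedValuation K L) where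
  val_isEquiv_comap := by
    have h : (extendedValuation K L).comap (algebraMap K L) = baseValuation K := by
      ext x
      exact spectralNorm_extends (L := L) x
    rw [h]
    exact .refl

/-- The ramification index `(v(L^×) : v(K^×))`, where the value `0` means that the index is
infinite (the convention of `Subgroup.index`). -/
noncomputable def ramificationIndex : ℕ :=
  (MonoidWithZeroHom.valueGroup (.ofClass (baseValuation K))).relIndex
    (MonoidWithZeroHom.valueGroup (.ofClass (extendedValuation K L)))

/-- An algebraic extension `L / K` is unramified if its ramification index is `1` and the extension
of residue fields is separable. -/
def IsUnramified : Prop :=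
  ramificationIndex K L = 1 ∧
    Algebra.IsSeparable (residueField K)
      (IsLocalRing.ResidueField (extendedValuation K L).valuationSubring)

/-- An algebraic extension `L / K` is infinitely ramified if `(v(L^×) : v(K^×))` is infinite. -/
def IsInfinitelyRamified : Prop := ramificationIndex K L = 0

end ValuedExtensions

section Dynamics

/-- The map `z ↦ z ^ ℓ - c`. -/
def powSub {R : Type*} [CommRing R] (ℓ : ℕ) (c : R) : R → R := fun z => z ^ ℓ - c

variable {α : Type*} (g : α → α)

/-- The forward orbit `{x, g x, g (g x), …}` of `x`. -/
def forwardOrbit (x : α) : Set α := Set.range fun n : ℕ => g^[n] x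

/-- The points `x` and `y` lie in a single cycle of `g`. -/
def InSingleCycle (x y : α) : Prop := x ∈ Function.periodicPts g ∧ y ∈ forwardOrbit g x

/-- The point `x` is preperiodic (some iterate of it is periodic) but not periodic. -/
def IsStrictlyPreperiodic (x : α) : Prop :=
  x ∉ Function.periodicPts g ∧ ∃ n : ℕ, g^[n] x ∈ Function.periodicPts g

end Dynamics

section Towers

variable (K : Type*) [Field K] (Ω : Type*) [Field Ω] [Algebra K Ω] (ℓ : ℕ) (c a : K)

/-- The field `K_n`, generated over `K` by the solutions in `Ω` of `f^n(z) = a`, where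
`f(z) = z ^ ℓ - c`. -/
noncomputable def levelField (n : ℕ) : IntermediateField K Ω :=
  IntermediateField.adjoin K
    {z : Ω | (powSub ℓ (algebraMap K Ω c))^[n] z = algebraMap K Ω a}

/-- The field `K_∞`, the compositum (which is the increasing union) of the fields `K_n`. -/
noncomputable def limitField : IntermediateField K Ω := ⨆ n : ℕ, levelField K Ω ℓ c a n

end Towers

end Arboreal

open scoped NNReal

namespace Arboreal

/-! ### Ultrametric estimates for iterates of `z ^ ℓ - c`. -/

section ValuedDynamics

variable {E : Type*} [Field E] {v : Valuation E ℝ≥0} {ℓ : ℕ} {c x y z : E}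

/-! The valuation is multiplicative: integral means `v z ≤ 1`, unit means `v z = 1`. Every
backward-orbit point is integral, and since `z ^ ℓ = f z + c`, each step up the tower extracts an
`ℓ`-th root. As `ℓ` is a residue unit, roots of units are unramified, so ramification can enter only
at nonzero nonunit points, those congruent to the critical point `0`.

Two fields absorb the tower: an unramified `M` closed under `ℓ`-th roots of units
(`exists_unramified_rootClosed`) and `M' ≥ M`, which also contains an `ℓ`-th root of a uniformizer
and whose values have `ℓ`-th powers in the value group of `K` (`exists_rootClosed_pair`). Both come
from Zorn's lemma and the orthogonality in `exists_aeval_eq_val_coeff_le`.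

(a) A nonunit `z` with `f^n z = a` would give `a ≡ f^n 0`, so there is none. (c) The only nonunit in
the backward orbit is `0` (`eq_zero_of_iterate_mem_cycle`). Both towers lie in `M`. (b) No branch
meets the class of `0` twice, since `0` would then be periodic in the residue field; one root of a
nonunit leads from `M` to `M'`, and later roots are of units. (d) Pulling a point back around the
residue cycle can be done so that `v y ≤ v y' ^ ℓ`. Repetition gives nonunits whose valuations tend
to `1` (`exists_backward_val_bound`), impossible for a finite index over a discrete value group. -/

theorem powSub_add (ℓ : ℕ) (c z : E) : powSub ℓ c z + c = z ^ ℓ := sub_add_cancel _ _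

theorem map_powSub {R S : Type*} [CommRing R] [CommRing S] (φ : R →+* S) (ℓ : ℕ) (c z : R) :
    φ (powSub ℓ c z) = powSub ℓ (φ c) (φ z) := by simp [powSub]

theorem map_powSub_iterate {R S : Type*} [CommRing R] [CommRing S] (φ : R →+* S) (ℓ : ℕ)
    (c z : R) (n : ℕ) : φ ((powSub ℓ c)^[n] z) = (powSub ℓ (φ c))^[n] (φ z) :=
  Function.Semiconj.iterate_right (map_powSub φ ℓ c) n z

theorem val_pow_sub_pow_le (hx : v x ≤ 1) (hy : v y ≤ 1) (ℓ : ℕ) :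
    v (x ^ ℓ - y ^ ℓ) ≤ v (x - y) := by
  rw [← (Commute.all x y).mul_geom_sum₂, map_mul]
  refine mul_le_of_le_one_right' (v.map_sum_le fun i _ => ?_)
  rw [map_mul, map_pow, map_pow]
  exact mul_le_one' (pow_le_one' hx _) (pow_le_one' hy _)

/-- If `ℓ` is a unit, the `ℓ`-th power map is an isometry on residue classes of units. -/
theorem val_pow_sub_pow (hℓ : v (ℓ : E) = 1) (hx : v x = 1) (h : v (x - y) < 1) :
    v (x ^ ℓ - y ^ ℓ) = v (x - y) := by
  have hy : v y ≤ 1 := by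
    have := v.map_sub x (x - y)
    rw [sub_sub_cancel] at this
    exact this.trans (max_le hx.le h.le)
  rw [← (Commute.all x y).mul_geom_sum₂, map_mul]
  -- Since `y ≡ x`, the cofactor of `x - y` is congruent to the unit `ℓ * x ^ (ℓ - 1)`.
  have key : v (∑ i ∈ Finset.range ℓ, x ^ i * y ^ (ℓ - 1 - i)
      - (ℓ : E) * x ^ (ℓ - 1)) < v ((ℓ : E) * x ^ (ℓ - 1)) := by
    have h1 : v ((ℓ : E) * x ^ (ℓ - 1)) = 1 := by simp [hℓ, hx]
    rw [h1, ← nsmul_eq_mul]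
    have h2 : ∑ i ∈ Finset.range ℓ, x ^ i * y ^ (ℓ - 1 - i) - ℓ • x ^ (ℓ - 1)
        = ∑ i ∈ Finset.range ℓ, (x ^ i * (y ^ (ℓ - 1 - i) - x ^ (ℓ - 1 - i))) := by
      simp_rw [mul_sub, Finset.sum_sub_distrib]
      congr 1
      rw [Finset.sum_congr rfl (g := fun _ => x ^ (ℓ - 1)), Finset.sum_const, Finset.card_range]
      intro i hi
      rw [← pow_add]
      congr 1
      have := Finset.mem_range.1 hi
      omega
    rw [h2]
    refine v.map_sum_lt one_ne_zero fun i _ => ?_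
    rw [map_mul, map_pow, hx, one_pow, one_mul]
    refine (val_pow_sub_pow_le hy hx.le _).trans_lt ?_
    rwa [v.map_sub_swap]
  have h3 := v.map_add_eq_of_lt_left key
  rw [add_sub_cancel] at h3
  rw [h3]
  simp [hℓ, hx]

theorem val_powSub_le_one (hc : v c ≤ 1) (hz : v z ≤ 1) : v (powSub ℓ c z) ≤ 1 :=
  (v.map_sub _ _).trans (max_le (by rw [map_pow]; exact pow_le_one' hz _) hc)

theorem val_iterate_le_one (hc : v c ≤ 1) (hz : v z ≤ 1) (n : ℕ) :
    v ((powSub ℓ c)^[n] z) ≤ 1 := by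
  induction n with
  | zero => exact hz
  | succ n ih => rw [Function.iterate_succ_apply']; exact val_powSub_le_one hc ih

theorem val_iterate_sub_le (hc : v c ≤ 1) (hx : v x ≤ 1) (hy : v y ≤ 1) (n : ℕ) :
    v ((powSub ℓ c)^[n] x - (powSub ℓ c)^[n] y) ≤ v (x - y) := by
  induction n with
  | zero => rfl
  | succ n ih =>
    rw [Function.iterate_succ_apply', Function.iterate_succ_apply']
    refine le_trans ?_ ih
    rw [powSub, powSub, sub_sub_sub_cancel_right]
    exact val_pow_sub_pow_le (val_iterate_le_one hc hx n) (val_iterate_le_one hc hy n) ℓ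

theorem val_le_one_of_iterate (hℓ : ℓ ≠ 0) (hc : v c ≤ 1) (n : ℕ)
    (h : v ((powSub ℓ c)^[n] z) ≤ 1) : v z ≤ 1 := by
  induction n generalizing z with
  | zero => exact h
  | succ n ih =>
    have h1 : v (powSub ℓ c z) ≤ 1 := ih h
    have h2 : v (z ^ ℓ) ≤ 1 := by
      rw [← powSub_add ℓ c]
      exact (v.map_add _ _).trans (max_le h1 hc)
    rw [map_pow] at h2
    exact (pow_le_one_iff hℓ).1 h2

theorem val_zero_iterate_le_one (hc : v c ≤ 1) (n : ℕ) : v ((powSub ℓ c)^[n] 0) ≤ 1 :=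
  val_iterate_le_one hc (by simp) n

/-- If `0` is periodic, then the points of its cycle other than `0` are units. -/
theorem iterate_zero_eq_zero (hℓ : 2 ≤ ℓ) (hc : v c ≤ 1)
    (hper : (0 : E) ∈ Function.periodicPts (powSub ℓ c)) {n : ℕ}
    (hn : v ((powSub ℓ c)^[n] 0) < 1) : (powSub ℓ c)^[n] 0 = 0 := by
  obtain ⟨N, hN, hp⟩ := hper
  obtain ⟨N, rfl⟩ := Nat.exists_eq_succ_of_ne_zero hN.ne'
  set x := (powSub ℓ c)^[n] 0 with hx
  have hpx : (powSub ℓ c)^[N + 1] x = x := hp.apply_iterate n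
  have hp0 : (powSub ℓ c)^[N + 1] 0 = 0 := hp
  by_contra hne
  -- Both `x` and `0` are fixed by `f^(N+1)`. The first application of `f` turns their difference
  -- into `x ^ ℓ`, and the other `N` do not enlarge it.
  have h1 : v x ≤ v x ^ ℓ := by
    have h2 := val_iterate_sub_le (ℓ := ℓ) hc (val_powSub_le_one (ℓ := ℓ) hc hn.le)
      (val_powSub_le_one (ℓ := ℓ) (z := 0) hc (by simp)) N
    rw [← Function.iterate_succ_apply, ← Function.iterate_succ_apply, hpx, hp0, sub_zero, powSub,
      powSub, sub_sub_sub_cancel_right, zero_pow (by omega), sub_zero, map_pow] at h2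
    exact h2
  have h3 : v x ^ ℓ < v x := by
    have := pow_lt_pow_right_of_lt_one₀ (zero_lt_iff.2 (v.ne_zero_iff.2 hne)) hn
      (show 1 < ℓ by omega)
    rwa [pow_one] at this
  exact absurd h1 h3.not_ge

/-- If `0` is periodic, then congruent points of its cycle are equal. -/
theorem iterate_zero_eq_of_val_sub_lt (hℓ : 2 ≤ ℓ) (hc : v c ≤ 1)
    (hper : (0 : E) ∈ Function.periodicPts (powSub ℓ c)) {m n : ℕ}
    (hn : v ((powSub ℓ c)^[m] 0 - (powSub ℓ c)^[n] 0) < 1) :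
    (powSub ℓ c)^[m] 0 = (powSub ℓ c)^[n] 0 := by
  obtain ⟨N, hN, hp⟩ := id hper
  have hcyc : ∀ k, (powSub ℓ c)^[k * N] 0 = 0 := fun k => by
    rw [mul_comm]; exact hp.mul_const k
  -- After `N * n - n` further steps `f^n 0` returns to `0`. The image of `f^m 0` is then a nonunit
  -- of the cycle, hence also `0`; another `n` steps give both `f^n 0` and `f^m 0`.
  have hr : N * n - n + n = n * N := by
    have : n ≤ N * n := Nat.le_mul_of_pos_left _ hN
    rw [mul_comm n]; omega
  have h1 := (val_iterate_sub_le (ℓ := ℓ) hc (val_zero_iterate_le_one (ℓ := ℓ) hc m)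
    (val_zero_iterate_le_one (ℓ := ℓ) hc n) (N * n - n)).trans_lt hn
  rw [← Function.iterate_add_apply, ← Function.iterate_add_apply, hr, hcyc, sub_zero] at h1
  have h2 := iterate_zero_eq_zero hℓ hc hper h1
  have h3 : (powSub ℓ c)^[n + (N * n - n + m)] 0 = (powSub ℓ c)^[n] 0 := by
    rw [Function.iterate_add_apply, h2]
  rw [← h3, ← add_assoc, add_comm n, hr, add_comm, Function.iterate_add_apply, hcyc]

/-- If `0` is periodic, the iterates are injective on the residue classes of its cycle, in the
fibres over the cycle. -/
theorem eq_iterate_zero (hℓ : 2 ≤ ℓ) (hℓ1 : v (ℓ : E) = 1) (hc : v c ≤ 1)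
    (hper : (0 : E) ∈ Function.periodicPts (powSub ℓ c)) (n i : ℕ)
    (hx : v (x - (powSub ℓ c)^[i] 0) < 1)
    (h : (powSub ℓ c)^[n] x = (powSub ℓ c)^[n] ((powSub ℓ c)^[i] 0)) :
    x = (powSub ℓ c)^[i] 0 := by
  have hi := val_zero_iterate_le_one (ℓ := ℓ) hc i
  induction n generalizing x i with
  | zero => exact h
  | succ n ih =>
    have hx1 : v x ≤ 1 := by
      rw [← sub_add_cancel x ((powSub ℓ c)^[i] 0)]
      exact (v.map_add _ _).trans (max_le hx.le hi)
    rw [Function.iterate_succ_apply, Function.iterate_succ_apply,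
      ← Function.iterate_succ_apply' (powSub ℓ c) i] at h
    have h1 := ih (x := powSub ℓ c x) (i + 1)
      (by rw [Function.iterate_succ_apply']
          exact (val_iterate_sub_le (ℓ := ℓ) hc hx1 hi 1).trans_lt hx) h
      (val_zero_iterate_le_one hc _)
    rw [Function.iterate_succ_apply', powSub, powSub, sub_left_inj] at h1
    -- A nonunit cycle point is `0`, whose only `ℓ`-th root is `0`; near a unit the power map is an
    -- isometry, hence injective.
    rcases hi.lt_or_eq with hlt | heq
    · have h0 := iterate_zero_eq_zero hℓ hc hper hlt
      have h1 : x ^ ℓ = ((powSub ℓ c)^[i] 0) ^ ℓ := h1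
      rw [h0, zero_pow (by omega)] at h1
      rw [h0]
      exact pow_eq_zero_iff (by omega) |>.1 h1
    · have h2 := val_pow_sub_pow hℓ1 heq (y := x) (by rwa [v.map_sub_swap])
      have h1 : x ^ ℓ = ((powSub ℓ c)^[i] 0) ^ ℓ := h1
      rw [h1, sub_self, map_zero, eq_comm, v.zero_iff, sub_eq_zero] at h2
      exact h2.symm

/-- Congruence gives `f^n 0 ≡ f^j 0`, which is an equality on the cycle. So `z` and `0` are
congruent with the same `n`-th image, and injectivity on the residue class applies. -/
theorem eq_zero_of_iterate_mem_cycle (hℓ : 2 ≤ ℓ) (hℓ1 : v (ℓ : E) = 1) (hc : v c ≤ 1)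
    (hper : (0 : E) ∈ Function.periodicPts (powSub ℓ c)) {n j : ℕ}
    (hz : v z < 1) (h : (powSub ℓ c)^[n] z = (powSub ℓ c)^[j] 0) : z = 0 := by
  have h1 : v ((powSub ℓ c)^[n] 0 - (powSub ℓ c)^[j] 0) < 1 := by
    rw [← h]
    refine (val_iterate_sub_le (ℓ := ℓ) hc (by simp) hz.le n).trans_lt ?_
    rwa [zero_sub, v.map_neg]
  refine eq_iterate_zero hℓ hℓ1 hc hper n 0 (by simpa using hz) ?_
  rw [h, ← iterate_zero_eq_of_val_sub_lt hℓ hc hper h1]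
  rfl

/-! ### Pulling points back along the critical orbit. -/

section Branches

variable [IsAlgClosed E]

/-- `x ^ ℓ - u` is the product of `x - r` over the roots `r` of `X ^ ℓ - u`; a product of valuation
below `1` has a factor of valuation below `1`. -/
theorem exists_pow_eq_val_sub_lt (hℓ : ℓ ≠ 0) {u : E} (h : v (u - x ^ ℓ) < 1) :
    ∃ r, r ^ ℓ = u ∧ v (r - x) < 1 := by
  classical
  by_contra! hcon
  set p : Polynomial E := Polynomial.X ^ ℓ - Polynomial.C u with hp
  have hm : p.Monic := Polynomial.monic_X_pow_sub_C u hℓ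
  have h1 : p.eval x = (p.roots.map fun r => x - r).prod := by
    conv_lhs => rw [(IsAlgClosed.splits p).eq_prod_roots_of_monic hm]
    rw [Polynomial.eval_multiset_prod, Multiset.map_map]
    simp
  have h2 : 1 ≤ v (p.eval x) := by
    rw [h1, map_multiset_prod, Multiset.map_map]
    refine Multiset.prod_induction (fun t : ℝ≥0 => 1 ≤ t) _ (fun _ _ => one_le_mul) le_rfl ?_
    intro t ht
    obtain ⟨r, hr, rfl⟩ := Multiset.mem_map.1 ht
    rw [Polynomial.mem_roots hm.ne_zero, Polynomial.IsRoot, hp] at hr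
    simp only [Function.comp_apply]
    rw [v.map_sub_swap]
    exact hcon r (by simpa [sub_eq_zero] using hr)
  rw [hp] at h2
  simp only [Polynomial.eval_sub, Polynomial.eval_pow, Polynomial.eval_X, Polynomial.eval_C] at h2
  rw [v.map_sub_swap] at h2
  exact absurd h h2.not_gt

/-- Any root of `1 + X + ⋯ + X ^ (ℓ - 1)` works: were it congruent to `1`, the isometry property
would make it equal to `1`, where the sum is `ℓ ≠ 0`. -/
theorem exists_root_of_unity_ne (hℓ : 2 ≤ ℓ) (hℓ1 : v (ℓ : E) = 1) :
    ∃ ζ : E, ζ ^ ℓ = 1 ∧ v ζ = 1 ∧ v (ζ - 1) = 1 := by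
  obtain ⟨ζ, hζ⟩ := IsAlgClosed.exists_root (∑ i ∈ Finset.range ℓ, (Polynomial.X : Polynomial E) ^ i)
    (by
      intro h0
      have h1 := Polynomial.coeff_eq_zero_of_degree_lt (n := 1) (h0.trans_lt (by norm_num))
      rw [Polynomial.finsetSum_coeff] at h1
      simp only [Polynomial.coeff_X_pow, Finset.sum_ite_eq, Finset.mem_range] at h1
      rw [if_pos (by omega)] at h1
      exact one_ne_zero h1)
  have hs : ∑ i ∈ Finset.range ℓ, ζ ^ i = 0 := by
    simpa [Polynomial.IsRoot, Polynomial.eval_finsetSum] using hζ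
  have hpow : ζ ^ ℓ = 1 := by
    have := mul_geom_sum ζ ℓ
    rw [hs, mul_zero, eq_comm, sub_eq_zero] at this
    exact this
  have hv : v ζ = 1 := by
    have := congrArg v hpow
    rw [map_pow, map_one] at this
    exact (pow_eq_one_iff_of_nonneg zero_le (by omega)).1 this
  refine ⟨ζ, hpow, hv, le_antisymm ((v.map_sub _ _).trans (by simp [hv])) ?_⟩
  by_contra! hlt
  have h1 := val_pow_sub_pow hℓ1 hv hlt
  rw [hpow, one_pow, sub_self, map_zero, eq_comm, v.zero_iff, sub_eq_zero] at h1
  subst h1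
  simp only [one_pow, Finset.sum_const, Finset.card_range, nsmul_eq_mul, mul_one] at hs
  rw [hs, map_zero] at hℓ1
  exact zero_ne_one hℓ1

/-- Backward lifting along the critical orbit: a point close to `f^s(0)` has an `s`-fold preimage
`y` close to `0`. -/
theorem exists_iterate_eq_val_pow (hℓ : ℓ ≠ 0) (hℓ1 : v (ℓ : E) = 1) {N : ℕ}
    (hN : ∀ s, 0 < s → s < N → v ((powSub ℓ c)^[s] 0) = 1) (s : ℕ) (hs : s + 1 ≤ N)
    (hz : v (z - (powSub ℓ c)^[s + 1] 0) < 1) :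
    ∃ y, (powSub ℓ c)^[s + 1] y = z ∧ v y ^ ℓ = v (z - (powSub ℓ c)^[s + 1] 0) := by
  induction s generalizing z with
  | zero =>
    obtain ⟨y, hy⟩ := IsAlgClosed.exists_pow_nat_eq (z + c) (Nat.pos_of_ne_zero hℓ)
    refine ⟨y, ?_, ?_⟩
    · simp [powSub, hy]
    · rw [← map_pow, hy]
      simp [powSub, hℓ]
  | succ s ih =>
    rw [Function.iterate_succ_apply'] at hz ⊢
    set x := (powSub ℓ c)^[s + 1] 0 with hx
    -- Extracting the root near the unit `x` preserves distances. The exponent `ℓ` arises only in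
    -- the base case, where the root is taken near `0`.
    have hx1 : v x = 1 := hN (s + 1) (by omega) (by omega)
    have he : z + c - x ^ ℓ = z - powSub ℓ c x := by simp [powSub]; ring
    obtain ⟨r, hr, hrx⟩ := exists_pow_eq_val_sub_lt hℓ (u := z + c) (x := x) (by rwa [he])
    obtain ⟨y, hy, hvy⟩ := ih (z := r) (by omega) hrx
    refine ⟨y, ?_, ?_⟩
    · rw [Function.iterate_succ_apply', hy, powSub, hr, add_sub_cancel_right]
    · rw [hvy, ← he, ← hr, v.map_sub_swap, ← val_pow_sub_pow hℓ1 hx1 (by rwa [v.map_sub_swap]),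
        v.map_sub_swap]

-- The orbit of `0` is `N`-periodic modulo nonunits. Representatives run over `1, …, N`, not `0, …,
-- N - 1`, because the lift needs at least one iteration.
omit [IsAlgClosed E] in
theorem exists_val_iterate_sub_lt (hc : v c ≤ 1) {N : ℕ} (hN : 0 < N)
    (he : v ((powSub ℓ c)^[N] 0) < 1) (n : ℕ) :
    ∃ j, 0 < j ∧ j ≤ N ∧ v ((powSub ℓ c)^[n] 0 - (powSub ℓ c)^[j] 0) < 1 := by
  induction n using Nat.strong_induction_on with
  | _ n ih =>
    rcases Nat.eq_zero_or_pos n with rfl | hn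
    · exact ⟨N, hN, le_rfl, by simpa using he⟩
    rcases le_or_gt n N with h | h
    · exact ⟨n, hn, h, by simp⟩
    obtain ⟨j, h0, h1, h2⟩ := ih (n - N) (by omega)
    refine ⟨j, h0, h1, ?_⟩
    have h3 : v ((powSub ℓ c)^[n] 0 - (powSub ℓ c)^[n - N] 0) < 1 := by
      obtain ⟨k, rfl⟩ := Nat.exists_eq_add_of_lt h
      rw [show N + k + 1 - N = k + 1 by omega, show N + k + 1 = (k + 1) + N by omega,
        Function.iterate_add_apply]
      refine (val_iterate_sub_le (ℓ := ℓ) hc he.le (by simp) _).trans_lt (by simpa using he)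
    have := v.map_add ((powSub ℓ c)^[n] 0 - (powSub ℓ c)^[n - N] 0)
      ((powSub ℓ c)^[n - N] 0 - (powSub ℓ c)^[j] 0)
    rw [sub_add_sub_cancel] at this
    exact this.trans_lt (max_lt h3 h2)

/-- If the residue classes of `0` and `a` lie in a single cycle, but `0` and `a` do not, then the
backward orbit of `a` contains points whose valuations have roots of unbounded order. -/
theorem exists_backward_val_bound (hℓ : 2 ≤ ℓ) (hℓ1 : v (ℓ : E) = 1) (hc : v c ≤ 1) {a : E}
    (hper : ∃ N, 0 < N ∧ v ((powSub ℓ c)^[N] 0) < 1)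
    (hmem : ∃ n, v (a - (powSub ℓ c)^[n] 0) < 1)
    (hnot : ¬ InSingleCycle (powSub ℓ c) 0 a) :
    ∃ τ : ℝ≥0, 0 < τ ∧ ∀ m, ∃ y n, (powSub ℓ c)^[n] y = a ∧ v y < 1 ∧ τ ≤ v y ^ ℓ ^ m := by
  classical
  have hℓ0 : ℓ ≠ 0 := by omega
  obtain ⟨hN, he⟩ := Nat.find_spec hper
  have hmin : ∀ s, 0 < s → s < Nat.find hper → v ((powSub ℓ c)^[s] 0) = 1 := fun s h0 hs =>
    le_antisymm (val_zero_iterate_le_one hc s)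
      (not_lt.1 fun h => Nat.find_min hper hs ⟨h0, h⟩)
  set N := Nat.find hper
  have lift : ∀ (z : E) (s : ℕ), 0 < s → s ≤ N → v (z - (powSub ℓ c)^[s] 0) < 1 →
      ∃ y, (powSub ℓ c)^[s] y = z ∧ v y ^ ℓ = v (z - (powSub ℓ c)^[s] 0) ∧ v y < 1 := by
    intro z s h0 hs hz
    obtain ⟨s, rfl⟩ := Nat.exists_eq_succ_of_ne_zero h0.ne'
    obtain ⟨y, h1, h2⟩ := exists_iterate_eq_val_pow hℓ0 hℓ1 hmin s hs hz
    exact ⟨y, h1, h2, (pow_lt_one_iff hℓ0).1 (h2.trans_lt hz)⟩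
  have hsub : ∀ y, v y < 1 → v (y - (powSub ℓ c)^[N] 0) < 1 := fun y hy =>
    (v.map_sub _ _).trans_lt (max_lt hy he)
  obtain ⟨ζ, hζ, hζ1, hζ2⟩ := exists_root_of_unity_ne hℓ hℓ1
  have step : ∀ y n, (powSub ℓ c)^[n + 1] y = a → v y < 1 →
      ∃ y' n', (powSub ℓ c)^[n' + 1] y' = a ∧ v y' < 1 ∧ v y ≤ v y' ^ ℓ := by
    intro y n hy hy1
    obtain ⟨y₁, h1, h2, h3⟩ : ∃ y₁, (powSub ℓ c)^[n + 1] y₁ = a ∧ v y₁ < 1 ∧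
        v y ≤ v (y₁ - (powSub ℓ c)^[N] 0) := by
      -- If `y` is too close to `f^N 0`, replace it by `ζ * y`: the image under `f` is unchanged,
      -- and `(ζ - 1) * y` dominates the new difference.
      rcases le_or_gt (v y) (v (y - (powSub ℓ c)^[N] 0)) with h | h
      · exact ⟨y, hy, hy1, h⟩
      · refine ⟨ζ * y, ?_, by simpa [hζ1] using hy1, ?_⟩
        · rw [Function.iterate_succ_apply] at hy ⊢
          rwa [show powSub ℓ c (ζ * y) = powSub ℓ c y by simp [powSub, mul_pow, hζ]]
        · have h4 : v ((ζ - 1) * y) = v y := by simp [hζ2]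
          rw [show ζ * y - (powSub ℓ c)^[N] 0 = (ζ - 1) * y + (y - (powSub ℓ c)^[N] 0) by ring,
            v.map_add_eq_of_lt_left (by rwa [h4]), h4]
    obtain ⟨y', h4, h5, h6⟩ := lift y₁ N hN le_rfl (hsub y₁ h2)
    refine ⟨y', n + N, ?_, h6, h3.trans h5.ge⟩
    rw [show n + N + 1 = (n + 1) + N by omega, Function.iterate_add_apply, h4, h1]
  obtain ⟨y₀, n₀, h₀, h₁, h₂⟩ : ∃ y n, (powSub ℓ c)^[n + 1] y = a ∧ v y < 1 ∧ v y ≠ 0 := by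
    obtain ⟨n, hn⟩ := hmem
    obtain ⟨j, hj0, hjN, hj⟩ := exists_val_iterate_sub_lt (ℓ := ℓ) hc hN he n
    have haj : v (a - (powSub ℓ c)^[j] 0) < 1 := by
      rw [← sub_add_sub_cancel a ((powSub ℓ c)^[n] 0)]
      exact (v.map_add _ _).trans_lt (max_lt hn hj)
    obtain ⟨y, h1, h2, h3⟩ := lift a j hj0 hjN haj
    obtain ⟨j, rfl⟩ := Nat.exists_eq_succ_of_ne_zero hj0.ne'
    -- If the lift of `a` is `0`, then `a` is in the orbit of `0`; one more turn gives a nonzero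
    -- point unless `f^N 0 = 0`, which would put `0` and `a` in one cycle.
    by_cases hy : y = 0
    · obtain ⟨y', h4, h5, h6⟩ := lift y N hN le_rfl (hsub y h3)
      refine ⟨y', j + N, ?_, h6, fun h0 => hnot ⟨⟨N, hN, ?_⟩, ⟨j + 1, ?_⟩⟩⟩
      · rw [show j + N + 1 = (j + 1) + N by omega, Function.iterate_add_apply, h4, h1]
      · rw [h0, zero_pow hℓ0, hy, zero_sub, v.map_neg, eq_comm, v.zero_iff] at h5
        exact h5
      · rw [← h1, hy]
    · exact ⟨y, j, h1, h3, v.ne_zero_iff.2 hy⟩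
  refine ⟨v y₀, zero_lt_iff.2 h₂, fun m => ?_⟩
  suffices ∃ y n, (powSub ℓ c)^[n + 1] y = a ∧ v y < 1 ∧ v y₀ ≤ v y ^ ℓ ^ m by
    obtain ⟨y, n, h⟩ := this
    exact ⟨y, n + 1, h⟩
  induction m with
  | zero => exact ⟨y₀, n₀, h₀, h₁, by simp⟩
  | succ m ih =>
    obtain ⟨y, n, h1, h2, h3⟩ := ih
    obtain ⟨y', n', h4, h5, h6⟩ := step y n h1 h2
    refine ⟨y', n', h4, h5, h3.trans ?_⟩
    rw [pow_succ', pow_mul]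
    exact pow_le_pow_left' h6 _

end Branches

end ValuedDynamics

open Polynomial IntermediateField

/-! ### Integrality of Lagrange interpolation. -/

section Interpolation

variable {E : Type*} [Field E] {v : Valuation E ℝ≥0}

theorem val_coeff_prod_le_one {ι : Type*} (s : Finset ι) (p : ι → E[X])
    (hp : ∀ i ∈ s, ∀ n, v ((p i).coeff n) ≤ 1) (n : ℕ) : v ((∏ i ∈ s, p i).coeff n) ≤ 1 := by
  refine Finset.prod_induction p (fun q => ∀ n, v (q.coeff n) ≤ 1) ?_ ?_ hp n
  · intro q r hq hr n
    rw [coeff_mul]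
    refine v.map_sum_le fun ij _ => ?_
    rw [map_mul]
    exact mul_le_one' (hq _) (hr _)
  · intro n
    rw [coeff_one]
    split_ifs <;> simp

/-- A polynomial of small degree is bounded by its values at integral nodes with distinct
residues. -/
theorem val_coeff_le_of_eval_le (s : Finset E) (hs : ∀ x ∈ s, v x ≤ 1)
    (hs' : ∀ x ∈ s, ∀ y ∈ s, x ≠ y → v (x - y) = 1) (f : E[X]) (hf : f.degree < s.card)
    {B : ℝ≥0} (hB : ∀ x ∈ s, v (f.eval x) ≤ B) (n : ℕ) : v (f.coeff n) ≤ B := by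
  classical
  rw [Lagrange.eq_interpolate (s := s) (v := id) (Set.injOn_id _) hf, Lagrange.interpolate_apply,
    finsetSum_coeff]
  refine v.map_sum_le fun x hx => ?_
  rw [coeff_C_mul, map_mul]
  refine (mul_le_of_le_one_right' ?_).trans (hB x hx)
  refine val_coeff_prod_le_one _ _ (fun y hy m => ?_) n
  rw [Lagrange.basisDivisor, coeff_C_mul, map_mul, map_inv₀]
  simp only [id]
  rw [hs' x hx y (Finset.mem_of_mem_erase hy) (Finset.ne_of_mem_erase hy).symm, inv_one, one_mul,
    coeff_sub, coeff_X, coeff_C]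
  refine (v.map_sub _ _).trans (max_le ?_ ?_)
  · split_ifs <;> simp
  · split_ifs
    · exact hs y (Finset.mem_of_mem_erase hy)
    · simp

end Interpolation

/-! ### Simple extensions and maximal intermediate fields. -/

section AlgebraicExtension

variable {K : Type*} [Field K] {Ω : Type*} [Field Ω] [Algebra K Ω]

theorem exists_aeval_eq [Algebra.IsAlgebraic K Ω] {F : IntermediateField K Ω} {z x : Ω} (hx : x ∈ F⟮z⟯) :
    ∃ p : F[X], aeval z p = x := by
  have hz : IsIntegral F z := Algebra.IsIntegral.isIntegral z
  rw [← mem_toSubalgebra, adjoin_simple_toSubalgebra_of_isAlgebraic hz.isAlgebraic,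
    Algebra.adjoin_singleton_eq_range_aeval] at hx
  exact hx

/-- Zorn's lemma for intermediate fields whose elements all have a given property. -/
theorem exists_maximal_intermediateField (Q : Ω → Prop) (F : IntermediateField K Ω)
    (hF : ∀ x ∈ F, Q x) :
    ∃ M, F ≤ M ∧ (∀ x ∈ M, Q x) ∧ ∀ M', M ≤ M' → (∀ x ∈ M', Q x) → M' ≤ M := by
  obtain ⟨M, hFM, hM⟩ := zorn_le_nonempty₀ {L : IntermediateField K Ω | ∀ x ∈ L, Q x}
    (by
      intro c hc hchain L hL
      refine ⟨sSup c, fun x hx => ?_, fun L hL => le_sSup hL⟩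
      have : Nonempty c := ⟨⟨L, hL⟩⟩
      rw [sSup_eq_iSup', ← SetLike.mem_coe, coe_iSup_of_directed hchain.directed] at hx
      obtain ⟨L', hx⟩ := Set.mem_iUnion.1 hx
      exact hc L'.2 x hx) F hF
  exact ⟨M, hFM, hM.prop, fun M' h1 h2 => hM.le_of_ge h2 h1⟩

end AlgebraicExtension

/-! ### Adjoining `ℓ`-th roots of units. -/

section ExtendedValuation

variable {K : Type*} [NontriviallyNormedField K] [IsUltrametricDist K] [CompleteSpace K]
  {Ω : Type*} [Field Ω] [Algebra K Ω] [Algebra.IsAlgebraic K Ω]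

theorem extendedValuation_algebraMap (x : K) :
    extendedValuation K Ω (algebraMap K Ω x) = baseValuation K x :=
  Subtype.ext (spectralNorm_extends x)

theorem extendedValuation_algEquiv (σ : Ω ≃ₐ[K] Ω) (x : Ω) :
    extendedValuation K Ω (σ x) = extendedValuation K Ω x :=
  Subtype.ext (spectralNorm_eq_of_equiv σ x).symm

theorem extendedValuation_coe (L : IntermediateField K Ω) (x : L) :
    extendedValuation K L x = extendedValuation K Ω (x : Ω) :=
  Subtype.ext (spectralNorm.eq_of_tower x)

variable {ℓ : ℕ}

/-- The powers of an `ℓ`-th root `z` of a unit are orthogonal: elements of `F(z)` are polynomials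
in `z` with coefficients of no larger valuation. -/
theorem exists_aeval_eq_val_coeff_le [IsAlgClosed Ω]
    (hℓ1 : extendedValuation K Ω (ℓ : Ω) = 1) {F : IntermediateField K Ω} {z x : Ω}
    (hz : extendedValuation K Ω z = 1) (hu : z ^ ℓ ∈ F) (hx : x ∈ F⟮z⟯) :
    ∃ h : F[X], aeval z h = x ∧
      ∀ n, extendedValuation K Ω (h.coeff n : Ω) ≤ extendedValuation K Ω x := by
  classical
  have hzi : IsIntegral F z := Algebra.IsIntegral.isIntegral z
  have hz0 : z ≠ 0 := by rintro rfl; simp at hz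
  have hℓ0 : (ℓ : F) ≠ 0 := fun h => by
    have h2 : (ℓ : Ω) = 0 := by simpa using congrArg (algebraMap F Ω) h
    rw [h2, map_zero] at hℓ1
    exact zero_ne_one hℓ1
  obtain ⟨p, rfl⟩ := exists_aeval_eq hx
  have hdvd : minpoly F z ∣ X ^ ℓ - C (⟨z ^ ℓ, hu⟩ : F) := minpoly.dvd _ _ (by simp)
  have hsep : (minpoly F z).Separable :=
    (separable_X_pow_sub_C _ hℓ0 fun h => pow_ne_zero ℓ hz0 (congrArg Subtype.val h)).of_dvd hdvd
  have hroot : ∀ r ∈ ((minpoly F z).rootSet Ω).toFinset, aeval r (minpoly F z) = 0 := by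
    intro r hr
    rw [Set.mem_toFinset, mem_rootSet] at hr
    exact hr.2
  have hpow : ∀ r ∈ ((minpoly F z).rootSet Ω).toFinset, r ^ ℓ = z ^ ℓ := by
    intro r hr
    have := aeval_eq_zero_of_dvd_aeval_eq_zero hdvd (hroot r hr)
    simpa [sub_eq_zero] using this
  have hval : ∀ r ∈ ((minpoly F z).rootSet Ω).toFinset, extendedValuation K Ω r = 1 := by
    intro r hr
    have h1 := congrArg (extendedValuation K Ω) (hpow r hr)
    rw [map_pow, map_pow, hz, one_pow] at h1
    exact (pow_eq_one_iff_of_nonneg zero_le (by rintro rfl; simp at hℓ0)).1 h1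
  refine ⟨p %ₘ minpoly F z, aeval_modByMonic_eq_self_of_root (minpoly.aeval F z), fun n => ?_⟩
  -- The nodes are the conjugates of `z`. As distinct `ℓ`-th roots of the same unit they have
  -- distinct residues, and the values there are conjugates of `x`, of equal valuation.
  have hc := val_coeff_le_of_eval_le (v := extendedValuation K Ω)
    ((minpoly F z).rootSet Ω).toFinset (fun r hr => (hval r hr).le) ?_
    ((p %ₘ minpoly F z).map (algebraMap F Ω)) ?_
    (B := extendedValuation K Ω (aeval z p)) ?_ n
  · rwa [coeff_map] at hc
  · intro r hr r' hr' hne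
    refine le_antisymm
      (((extendedValuation K Ω).map_sub _ _).trans (by simp [hval r hr, hval r' hr'])) ?_
    by_contra! hlt
    have h1 := val_pow_sub_pow hℓ1 (hval r hr) hlt
    rw [hpow r hr, hpow r' hr', sub_self, map_zero, eq_comm, Valuation.zero_iff, sub_eq_zero] at h1
    exact hne h1
  · rw [degree_map, Set.toFinset_card,
      card_rootSet_eq_natDegree hsep (IsAlgClosed.splits _),
      ← degree_eq_natDegree (minpoly.ne_zero hzi)]
    exact degree_modByMonic_lt _ (minpoly.monic hzi)
  · intro r hr
    have hconj : IsConjRoot F z r := isConjRoot_of_aeval_eq_zero hzi (hroot r hr)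
    have : IsAlgClosure F Ω := ⟨inferInstance, Algebra.IsAlgebraic.tower_top (K := K) F⟩
    have := IsAlgClosure.normal F Ω
    obtain ⟨σ, hσ⟩ := hconj.symm.exists_algEquiv
    rw [eval_map_algebraMap, ← hσ, ← AlgEquiv.coe_toAlgHom, aeval_algHom_apply,
      aeval_modByMonic_eq_self_of_root (minpoly.aeval F z)]
    exact (extendedValuation_algEquiv (σ.restrictScalars K) _).le

/-- If every coefficient of the orthogonal expansion had valuation below that of a nonzero `x`, so
would their combination `x`. Thus unit roots do not enlarge the value group. -/
theorem exists_val_eq_of_mem_adjoin [IsAlgClosed Ω]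
    (hℓ1 : extendedValuation K Ω (ℓ : Ω) = 1) {F : IntermediateField K Ω} {z x : Ω}
    (hz : extendedValuation K Ω z = 1) (hu : z ^ ℓ ∈ F) (hx : x ∈ F⟮z⟯) :
    ∃ y ∈ F, extendedValuation K Ω y = extendedValuation K Ω x := by
  obtain ⟨h, rfl, hle⟩ := exists_aeval_eq_val_coeff_le hℓ1 hz hu hx
  by_cases h0 : aeval z h = 0
  · exact ⟨0, zero_mem _, by rw [h0]⟩
  by_contra! hcon
  refine lt_irrefl (extendedValuation K Ω (aeval z h)) ?_
  conv_lhs => rw [aeval_eq_sum_range]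
  refine Valuation.map_sum_lt _ (by simpa using h0) fun n _ => ?_
  rw [Algebra.smul_def, map_mul, map_pow, hz, one_pow, mul_one]
  exact (hle n).lt_of_ne (hcon _ (h.coeff n).2)

theorem exists_rootClosed (Q : Ω → Prop)
    (hQ : ∀ (F : IntermediateField K Ω) (z : Ω), extendedValuation K Ω z = 1 → z ^ ℓ ∈ F →
      (∀ x ∈ F, Q x) → ∀ x ∈ F⟮z⟯, Q x)
    (F : IntermediateField K Ω) (hF : ∀ x ∈ F, Q x) :
    ∃ M, F ≤ M ∧ (∀ x ∈ M, Q x) ∧ ∀ z, extendedValuation K Ω z = 1 → z ^ ℓ ∈ M → z ∈ M := by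
  obtain ⟨M, h1, h2, h3⟩ := exists_maximal_intermediateField Q F hF
  refine ⟨M, h1, h2, fun z hz hu => ?_⟩
  refine h3 (restrictScalars K M⟮z⟯) (fun x hx => ?_) (hQ M z hz hu h2)
    (mem_adjoin_simple_self M z)
  exact (M⟮z⟯).algebraMap_mem ⟨x, hx⟩

end ExtendedValuation

/-! ### Unramified elements and residue fields. -/

section Ramification

variable {K : Type*} [NontriviallyNormedField K] [IsUltrametricDist K] [CompleteSpace K]
  {Ω : Type*} [Field Ω] [Algebra K Ω] [Algebra.IsAlgebraic K Ω]

theorem mem_valueGroup_iff_exists {E : Type*} [Field E] (v : Valuation E ℝ≥0) (u : ℝ≥0ˣ) :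
    u ∈ MonoidWithZeroHom.valueGroup (.ofClass v) ↔ ∃ x, v x = u := by
  constructor
  · intro hu
    have h1 : (u : ℝ≥0) ∈ Units.val '' (MonoidWithZeroHom.valueGroup (.ofClass v) : Set ℝ≥0ˣ) :=
      ⟨u, hu, rfl⟩
    rw [MonoidWithZeroHom.valueGroup_eq_range] at h1
    exact h1.1
  · rintro ⟨x, hx⟩
    exact MonoidWithZeroHom.mem_valueGroup _ ⟨x, hx⟩

/-- `x` has a valuation in the value group of `K`, and a separable residue if it is integral. -/
def IsUnramifiedElement (K : Type*) [NontriviallyNormedField K] [IsUltrametricDist K]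
    [CompleteSpace K] {Ω : Type*} [Field Ω] [Algebra K Ω] [Algebra.IsAlgebraic K Ω]
    (x : Ω) : Prop :=
  (∃ y : K, baseValuation K y = extendedValuation K Ω x) ∧
    ∀ h : extendedValuation K Ω x ≤ 1,
      IsLocalRing.residue (extendedValuation K Ω).valuationSubring ⟨x, h⟩ ∈
        separableClosure (residueField K)
          (IsLocalRing.ResidueField (extendedValuation K Ω).valuationSubring)

theorem isUnramifiedElement_algebraMap (y : K) :
    IsUnramifiedElement K (algebraMap K Ω y) := by
  refine ⟨⟨y, (extendedValuation_algebraMap y).symm⟩, fun h => ?_⟩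
  have h' : baseValuation K y ≤ 1 := by rwa [extendedValuation_algebraMap] at h
  exact (separableClosure (residueField K)
    (IsLocalRing.ResidueField (extendedValuation K Ω).valuationSubring)).algebraMap_mem
      (IsLocalRing.residue (integers K) ⟨y, h'⟩)

theorem mem_separableClosure_of_pow_mem {k κ : Type*} [Field k] [Field κ] [Algebra k κ] {ℓ : ℕ}
    (hℓ : (ℓ : κ) ≠ 0) {z : κ} (hz : z ≠ 0) (h : z ^ ℓ ∈ separableClosure k κ) :
    z ∈ separableClosure k κ := by
  have hs : IsSeparable (separableClosure k κ) z := by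
    have hℓ' : (ℓ : separableClosure k κ) ≠ 0 := fun h0 =>
      hℓ (by simpa using congrArg (algebraMap (separableClosure k κ) κ) h0)
    refine (separable_X_pow_sub_C (⟨z ^ ℓ, h⟩ : separableClosure k κ) hℓ'
      fun h0 => pow_ne_zero ℓ hz (congrArg Subtype.val h0)).of_dvd (minpoly.dvd _ _ (by simp))
  have h1 : z ∈ separableClosure (separableClosure k κ) κ := hs
  rw [separableClosure.separableClosure_eq_bot] at h1
  obtain ⟨y, rfl⟩ := mem_bot.1 h1
  exact y.2

theorem isUnit_valuationSubring_iff {E : Type*} [Field E] {v : Valuation E ℝ≥0}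
    {x : v.valuationSubring} : IsUnit x ↔ v (x : E) = 1 :=
  (Valuation.integer.integers v).isUnit_iff_valuation_eq_one

theorem residue_ne_zero {E : Type*} [Field E] {v : Valuation E ℝ≥0} {x : E} (hx : v x = 1) :
    IsLocalRing.residue v.valuationSubring ⟨x, hx.le⟩ ≠ 0 := by
  rw [IsLocalRing.residue_ne_zero_iff_isUnit]
  exact isUnit_valuationSubring_iff.2 hx

/-- An integral element has an expansion with integral coefficients, so its residue is a polynomial
in the separable residue of `z` with separable coefficients. -/
theorem isUnramifiedElement_of_mem_adjoin [IsAlgClosed Ω] {ℓ : ℕ}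
    (hℓ1 : extendedValuation K Ω (ℓ : Ω) = 1) (F : IntermediateField K Ω) (z : Ω)
    (hz : extendedValuation K Ω z = 1) (hu : z ^ ℓ ∈ F)
    (hF : ∀ x ∈ F, IsUnramifiedElement K x) (x : Ω) (hx : x ∈ F⟮z⟯) :
    IsUnramifiedElement K x := by
  constructor
  · obtain ⟨y, hy, hyx⟩ := exists_val_eq_of_mem_adjoin hℓ1 hz hu hx
    rw [← hyx]
    exact (hF y hy).1
  · intro hx1
    obtain ⟨h, rfl, hle⟩ := exists_aeval_eq_val_coeff_le hℓ1 hz hu hx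
    set V := (extendedValuation K Ω).valuationSubring
    have hzS : IsLocalRing.residue V ⟨z, hz.le⟩ ∈ separableClosure (residueField K)
        (IsLocalRing.ResidueField V) := by
      refine mem_separableClosure_of_pow_mem (ℓ := ℓ) ?_ (residue_ne_zero hz) ?_
      · have := residue_ne_zero hℓ1
        rwa [show (⟨(ℓ : Ω), hℓ1.le⟩ : V) = (ℓ : V) from rfl, map_natCast] at this
      · rw [← map_pow]
        exact (hF _ hu).2 (by rw [map_pow, hz, one_pow])
    have hsum : (⟨aeval z h, hx1⟩ : V) = ∑ n ∈ Finset.range (h.natDegree + 1),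
        (⟨(h.coeff n : Ω), (hle n).trans hx1⟩ : V) * ⟨z, hz.le⟩ ^ n := by
      apply Subtype.ext
      refine (aeval_eq_sum_range z).trans ?_
      push_cast
      rfl
    rw [hsum, map_sum]
    refine sum_mem fun n _ => ?_
    rw [map_mul, map_pow]
    exact mul_mem ((hF _ (h.coeff n).2).2 _) (pow_mem hzS n)

/-- The map of residue fields induced by the inclusion of an intermediate field. -/
noncomputable def residueFieldInclusion (L : IntermediateField K Ω) :
    IsLocalRing.ResidueField (extendedValuation K L).valuationSubring →ₐ[residueField K]
      IsLocalRing.ResidueField (extendedValuation K Ω).valuationSubring :=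
  haveI : (extendedValuation K L).HasExtension (extendedValuation K Ω) :=
    ⟨by
      rw [show (extendedValuation K Ω).comap (algebraMap L Ω) = extendedValuation K L from
        Valuation.ext fun x => (extendedValuation_coe L x).symm]
      exact .refl⟩
  { algebraMap (IsLocalRing.ResidueField (extendedValuation K L).valuationSubring)
      (IsLocalRing.ResidueField (extendedValuation K Ω).valuationSubring) with
    commutes' := fun r => by
      obtain ⟨r, rfl⟩ := IsLocalRing.residue_surjective r
      rfl }

theorem residueFieldInclusion_residue (L : IntermediateField K Ω) (x : L)
    (hx : extendedValuation K L x ≤ 1) :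
    residueFieldInclusion L (IsLocalRing.residue (extendedValuation K L).valuationSubring ⟨x, hx⟩) =
      IsLocalRing.residue (extendedValuation K Ω).valuationSubring
        ⟨(x : Ω), (extendedValuation_coe L x).symm.trans_le hx⟩ :=
  rfl

theorem isUnramified_of_forall (L : IntermediateField K Ω)
    (hL : ∀ x ∈ L, IsUnramifiedElement K x) : IsUnramified K L := by
  constructor
  · rw [ramificationIndex, Subgroup.relIndex_eq_one]
    intro u hu
    rw [mem_valueGroup_iff_exists] at hu ⊢
    obtain ⟨x, hx⟩ := hu
    obtain ⟨y, hy⟩ := (hL x x.2).1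
    exact ⟨y, by rw [hy, ← extendedValuation_coe, hx]⟩
  · refine ⟨fun r => ?_⟩
    obtain ⟨⟨x, hx⟩, rfl⟩ := IsLocalRing.residue_surjective r
    rw [← mem_separableClosure_iff, ← map_mem_separableClosure_iff (residueFieldInclusion L)]
    erw [residueFieldInclusion_residue]
    exact (hL x x.2).2 _

/-- There is an unramified extension of `K` that is closed under `ℓ`-th roots of units. -/
theorem exists_unramified_rootClosed [IsAlgClosed Ω] {ℓ : ℕ}
    (hℓ1 : extendedValuation K Ω (ℓ : Ω) = 1) :
    ∃ M : IntermediateField K Ω, (∀ x ∈ M, IsUnramifiedElement K x) ∧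
      ∀ z, extendedValuation K Ω z = 1 → z ^ ℓ ∈ M → z ∈ M := by
  obtain ⟨M, -, h⟩ := exists_rootClosed (K := K) (Ω := Ω) (IsUnramifiedElement K)
    (isUnramifiedElement_of_mem_adjoin hℓ1) ⊥ (by
      intro x hx
      obtain ⟨y, rfl⟩ := mem_bot.1 hx
      exact isUnramifiedElement_algebraMap y)
  exact ⟨M, h⟩

end Ramification

/-! ### Indices of cyclic subgroups. -/

theorem relIndex_zpowers_pow_dvd {G : Type*} [CommGroup G] (γ : G) (n : ℕ) :
    (Subgroup.zpowers (γ ^ n)).relIndex (Subgroup.zpowers γ) ∣ n := by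
  conv_lhs => rw [← QuotientGroup.ker_mk' (Subgroup.zpowers (γ ^ n))]
  rw [Subgroup.relIndex_ker, MonoidHom.map_zpowers, Nat.card_zpowers, orderOf_dvd_iff_pow_eq_one,
    ← map_pow, QuotientGroup.mk'_apply, QuotientGroup.eq_one_iff]
  exact Subgroup.mem_zpowers _

/-- The `n`-th power map is injective, so the index is that of `⟨γ ^ n⟩` in the group of `n`-th
powers of `H`, which sits between `⟨γ ^ n⟩` and `⟨γ⟩`. -/
theorem relIndex_dvd_of_pow_mem {G : Type*} [CommGroup G] [IsMulTorsionFree G] {γ : G}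
    {H : Subgroup G} {n : ℕ} (hn : n ≠ 0) (hγ : γ ∈ H)
    (h : ∀ b ∈ H, b ^ n ∈ Subgroup.zpowers γ) : (Subgroup.zpowers γ).relIndex H ∣ n := by
  have hinj : Function.Injective (powMonoidHom n : G →* G) := pow_left_injective hn
  rw [← Subgroup.relIndex_map_map_of_injective _ _ hinj]
  have hle : H.map (powMonoidHom n) ≤ Subgroup.zpowers γ := by
    rintro _ ⟨b, hb, rfl⟩
    exact h b hb
  have hle' : (Subgroup.zpowers γ).map (powMonoidHom n) ≤ H.map (powMonoidHom n) :=
    Subgroup.map_mono (by rwa [Subgroup.zpowers_le])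
  refine (Dvd.intro _ (Subgroup.relIndex_mul_relIndex _ _ _ hle' hle)).trans ?_
  rw [MonoidHom.map_zpowers, powMonoidHom_apply]
  exact relIndex_zpowers_pow_dvd γ n

/-! ### Ramification over a discrete value group. -/

section Ramification

variable {K : Type*} [NontriviallyNormedField K] [IsUltrametricDist K] [CompleteSpace K]
  [(baseValuation K).IsRankOneDiscrete]
  {Ω : Type*} [Field Ω] [Algebra K Ω] [Algebra.IsAlgebraic K Ω] {ℓ : ℕ}

theorem ramificationIndex_dvd (hℓ : ℓ ≠ 0) (L : IntermediateField K Ω)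
    (hL : ∀ x ∈ L, ∃ y : K, baseValuation K y = extendedValuation K Ω x ^ ℓ) :
    ramificationIndex K L ∣ ℓ := by
  rw [ramificationIndex, ← Valuation.IsRankOneDiscrete.generator_zpowers_eq_valueGroup]
  refine relIndex_dvd_of_pow_mem hℓ ?_ fun b hb => ?_
  · obtain ⟨y, hy⟩ := (mem_valueGroup_iff_exists _ _).1
      (Valuation.IsRankOneDiscrete.generator_mem_valueGroup (baseValuation K))
    refine (mem_valueGroup_iff_exists _ _).2 ⟨algebraMap K L y, ?_⟩
    rw [extendedValuation_algebraMap, hy]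
  · rw [Valuation.IsRankOneDiscrete.generator_zpowers_eq_valueGroup, mem_valueGroup_iff_exists]
    obtain ⟨x, hx⟩ := (mem_valueGroup_iff_exists _ _).1 hb
    obtain ⟨y, hy⟩ := hL x x.2
    exact ⟨y, by rw [hy, ← extendedValuation_coe, hx, Units.val_pow_eq_pow_val]⟩

/-- Roots of unbounded order in the value group force infinite ramification. -/
theorem isInfinitelyRamified_of_roots (hℓ : 2 ≤ ℓ) (L : IntermediateField K Ω) {τ : ℝ≥0}
    (hτ : 0 < τ) (h : ∀ m : ℕ, ∃ y ∈ L, extendedValuation K Ω y < 1 ∧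
      τ ≤ extendedValuation K Ω y ^ ℓ ^ m) : IsInfinitelyRamified K L := by
  rw [IsInfinitelyRamified, ramificationIndex]
  by_contra hne
  set e := (MonoidWithZeroHom.valueGroup (.ofClass (baseValuation K))).relIndex
    (MonoidWithZeroHom.valueGroup (.ofClass (extendedValuation K L)))
  set γ := Valuation.IsRankOneDiscrete.generator (baseValuation K) with hγ
  have hγ1 : γ < 1 := Valuation.IsRankOneDiscrete.generator_lt_one _
  -- For a finite index `e`, some power `b ^ n` with `0 < n ≤ e` is a power of `γ`, with positive
  -- exponent because `b < 1`.
  have hbound : ∀ y ∈ L, extendedValuation K Ω y < 1 → extendedValuation K Ω y ≠ 0 →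
      extendedValuation K Ω y ^ e ≤ γ := by
    intro y hy hy1 hy0
    set b : ℝ≥0ˣ := Units.mk0 _ hy0 with hb
    have hb1 : b < 1 := by rw [← Units.val_lt_val]; exact hy1
    have hmem : b ∈ MonoidWithZeroHom.valueGroup (.ofClass (extendedValuation K L)) :=
      (mem_valueGroup_iff_exists _ _).2 ⟨⟨y, hy⟩, extendedValuation_coe L _⟩
    obtain ⟨n, hn0, hne, hn⟩ := Subgroup.exists_pow_mem_of_relIndex_ne_zero hne hmem
    have hn := hn.1
    rw [← Valuation.IsRankOneDiscrete.generator_zpowers_eq_valueGroup] at hn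
    obtain ⟨k, hk⟩ := Subgroup.mem_zpowers_iff.1 hn
    have hk0 : 0 < k := by
      by_contra! hk0
      have h1 : 1 ≤ b ^ n := by
        obtain ⟨m, rfl⟩ := Int.exists_eq_neg_ofNat hk0
        rw [← hk, zpow_neg, zpow_natCast, one_le_inv']
        exact pow_le_one' hγ1.le m
      exact absurd h1 (pow_lt_one' hb1 (by omega)).not_ge
    have h2 : b ^ n ≤ γ := by
      rw [← hk]
      obtain ⟨k, rfl⟩ := Int.eq_ofNat_of_zero_le hk0.le
      rw [zpow_natCast]
      simpa using pow_le_pow_right_of_le_one' hγ1.le (show 1 ≤ k by omega)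
    have h3 : b ^ e ≤ γ := (pow_le_pow_right_of_le_one' hb1.le hne).trans h2
    rw [← Units.val_le_val] at h3
    exact h3
  have hγ1' : (γ : ℝ≥0) < 1 := by rw [← Units.val_one, Units.val_lt_val]; exact hγ1
  obtain ⟨m, hm⟩ := exists_pow_lt_of_lt_one (pow_pos hτ e) hγ1'
  obtain ⟨y, hy, hy1, hyτ⟩ := h m
  have hy0 : extendedValuation K Ω y ≠ 0 := by
    intro h0
    rw [h0, zero_pow (pow_ne_zero _ (by omega))] at hyτ
    exact hτ.not_ge hyτ
  have h1 : τ ^ e ≤ (γ : ℝ≥0) ^ ℓ ^ m := by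
    refine (pow_le_pow_left' hyτ e).trans ?_
    rw [← pow_mul, mul_comm, pow_mul]
    exact pow_le_pow_left' (hbound y hy hy1 hy0) _
  have h2 : (γ : ℝ≥0) ^ ℓ ^ m ≤ (γ : ℝ≥0) ^ m :=
    pow_le_pow_right_of_le_one' hγ1'.le (Nat.lt_pow_self (by omega)).le
  exact absurd (h1.trans h2) hm.not_ge

/-- Adjoining an `ℓ`-th root of a generator of the value group. -/
theorem exists_val_eq_pow_of_mem_adjoin (hℓ : ℓ ≠ 0) {M : IntermediateField K Ω}
    (hM : ∀ x ∈ M, ∃ y : K, baseValuation K y = extendedValuation K Ω x) {π : K} {ϖ : Ω}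
    (hπ : baseValuation K π = Valuation.IsRankOneDiscrete.generator (baseValuation K))
    (hϖ : ϖ ^ ℓ = algebraMap K Ω π) {x : Ω} (hx : x ∈ M⟮ϖ⟯) :
    ∃ y : K, baseValuation K y = extendedValuation K Ω x ^ ℓ := by
  classical
  set γ := Valuation.IsRankOneDiscrete.generator (baseValuation K) with hγ
  have hγ1 : γ < 1 := Valuation.IsRankOneDiscrete.generator_lt_one _
  set v := extendedValuation K Ω with hv
  have hvϖ : v ϖ ^ ℓ = γ := by rw [← map_pow, hϖ, extendedValuation_algebraMap, hπ]
  have hϖ0 : v ϖ ≠ 0 := by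
    intro h0
    rw [h0, zero_pow hℓ] at hvϖ
    exact γ.ne_zero hvϖ.symm
  -- The powers of `ϖ` below `ℓ` have values in distinct cosets of `⟨γ⟩`: an equality would make `ℓ`
  -- divide `j - i`. Hence the largest term of an expansion determines its valuation.
  have key : ∀ i j : ℕ, i < j → j < ℓ → ∀ a ∈ M, ∀ b ∈ M, a ≠ 0 → b ≠ 0 →
      v (a * ϖ ^ i) ≠ v (b * ϖ ^ j) := by
    intro i j hij hj a ha b hb ha0 hb0 h
    obtain ⟨d, rfl⟩ := Nat.exists_eq_add_of_lt hij
    rw [map_mul, map_mul, map_pow, map_pow, show i + d + 1 = (d + 1) + i by ring, pow_add,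
      ← mul_assoc] at h
    have h1 := mul_right_cancel₀ (pow_ne_zero i hϖ0) h
    obtain ⟨t, ht⟩ := hM (a / b) (div_mem ha hb)
    have h2 : baseValuation K t = v ϖ ^ (d + 1) := by
      rw [ht, map_div₀, h1]
      exact mul_div_cancel_left₀ _ (v.ne_zero_iff.2 hb0)
    have h3 : Units.mk0 (v ϖ) hϖ0 ^ (d + 1) ∈ Subgroup.zpowers γ := by
      rw [hγ, Valuation.IsRankOneDiscrete.generator_zpowers_eq_valueGroup,
        mem_valueGroup_iff_exists]
      exact ⟨t, by rw [h2]; simp⟩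
    obtain ⟨m, hm⟩ := Subgroup.mem_zpowers_iff.1 h3
    have h4 : Units.mk0 (v ϖ) hϖ0 ^ ℓ = γ := by
      apply Units.ext
      rw [Units.val_pow_eq_pow_val, Units.val_mk0, hvϖ]
    have h5 : γ ^ (m * ℓ) = γ ^ ((d + 1 : ℕ) : ℤ) := by
      rw [zpow_mul, hm, zpow_natCast, zpow_natCast, ← pow_mul, mul_comm, pow_mul, h4]
    have h6 : m * ℓ = ((d + 1 : ℕ) : ℤ) := by
      refine (zpow_right_strictAnti₀ (zero_lt_iff.2 γ.ne_zero)
        (show (γ : ℝ≥0) < 1 from hγ1)).injective ?_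
      simpa only [Units.val_zpow_eq_zpow_val] using congrArg Units.val h5
    have h7 : (ℓ : ℤ) ∣ ((d + 1 : ℕ) : ℤ) := Dvd.intro_left m h6
    have h8 := Nat.le_of_dvd (by omega) (Int.natCast_dvd_natCast.1 h7)
    omega
  set π' : M := algebraMap K M π with hπ'
  obtain ⟨p, hp⟩ := exists_aeval_eq hx
  have hmonic : (X ^ ℓ - C π').Monic := monic_X_pow_sub_C _ hℓ
  set h := p %ₘ (X ^ ℓ - C π') with hh
  have hhx : aeval ϖ h = x := by
    rw [hh, aeval_modByMonic_eq_self_of_root, hp]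
    simp only [map_sub, map_pow, aeval_X, aeval_C, hϖ, hπ']
    exact sub_self _
  have hdeg : h.natDegree < ℓ := by
    have h1 := natDegree_modByMonic_lt p hmonic (fun h1 => by
      have := congrArg natDegree h1
      rw [natDegree_X_pow_sub_C, natDegree_one] at this
      exact hℓ this)
    rwa [natDegree_X_pow_sub_C] at h1
  by_cases hx0 : x = 0
  · exact ⟨0, by rw [hx0, map_zero, map_zero, zero_pow hℓ]⟩
  set f : ℕ → Ω := fun n => (h.coeff n : Ω) * ϖ ^ n with hf
  have hsum : x = ∑ n ∈ Finset.range (h.natDegree + 1), f n := by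
    rw [← hhx, aeval_eq_sum_range]
    rfl
  obtain ⟨j, hj, hjmax⟩ := Finset.exists_max_image (Finset.range (h.natDegree + 1))
    (fun n => v (f n)) ⟨0, by simp⟩
  have hfj : f j ≠ 0 := by
    intro h0
    apply hx0
    rw [hsum]
    refine Finset.sum_eq_zero fun n hn => ?_
    have := hjmax n hn
    rw [h0, map_zero, le_zero_iff, v.zero_iff] at this
    exact this
  have hvx : v x = v (f j) := by
    rw [hsum]
    refine v.map_sum_eq_of_lt hj fun i hi => ?_
    rw [Finset.mem_sdiff, Finset.mem_singleton] at hi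
    refine (hjmax i hi.1).lt_of_ne fun heq => ?_
    have hfi : f i ≠ 0 := by
      rw [← v.ne_zero_iff, heq, v.ne_zero_iff]
      exact hfj
    have hi' := Finset.mem_range.1 hi.1
    have hj' := Finset.mem_range.1 hj
    rcases lt_or_gt_of_ne hi.2 with hlt | hlt
    · exact key i j hlt (by omega) _ (h.coeff i).2 _ (h.coeff j).2 (left_ne_zero_of_mul hfi)
        (left_ne_zero_of_mul hfj) heq
    · exact key j i hlt (by omega) _ (h.coeff j).2 _ (h.coeff i).2 (left_ne_zero_of_mul hfj)
        (left_ne_zero_of_mul hfi) heq.symm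
  obtain ⟨t, ht⟩ := hM _ (h.coeff j).2
  refine ⟨t ^ ℓ * π ^ j, ?_⟩
  rw [hvx, hf, map_mul, map_mul, map_pow, map_pow, map_pow, ht, mul_pow, ← pow_mul, mul_comm j ℓ,
    pow_mul, hvϖ, hπ]

/-- There are an unramified extension `M` of `K` that is closed under `ℓ`-th roots of units, and
an extension `M'` of `M` whose value group has exponent `ℓ` over that of `K`, that is closed under
`ℓ`-th roots of units and contains all `ℓ`-th roots of elements of `M`. -/
theorem exists_rootClosed_pair [IsAlgClosed Ω] (hℓ : ℓ ≠ 0)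
    (hℓ1 : extendedValuation K Ω (ℓ : Ω) = 1) :
    ∃ M M' : IntermediateField K Ω, M ≤ M' ∧
      (∀ x ∈ M', ∃ y : K, baseValuation K y = extendedValuation K Ω x ^ ℓ) ∧
      (∀ z, extendedValuation K Ω z = 1 → z ^ ℓ ∈ M → z ∈ M) ∧
      (∀ z, extendedValuation K Ω z = 1 → z ^ ℓ ∈ M' → z ∈ M') ∧
      ∀ z, z ^ ℓ ∈ M → z ∈ M' := by
  obtain ⟨M, hM, hMroot⟩ := exists_unramified_rootClosed (K := K) hℓ1
  obtain ⟨π, hπ⟩ := Valuation.IsRankOneDiscrete.generator_mem_range K (baseValuation K)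
  obtain ⟨ϖ, hϖ⟩ := IsAlgClosed.exists_pow_nat_eq (algebraMap K Ω π) (Nat.pos_of_ne_zero hℓ)
  set γ := Valuation.IsRankOneDiscrete.generator (baseValuation K) with hγ
  obtain ⟨M', hM', hval, hroot⟩ := exists_rootClosed (K := K) (ℓ := ℓ)
    (fun x : Ω => ∃ y : K, baseValuation K y = extendedValuation K Ω x ^ ℓ)
    (fun F z hz hu hF x hx => by
      obtain ⟨y, hy, hyx⟩ := exists_val_eq_of_mem_adjoin hℓ1 hz hu hx
      rw [← hyx]
      exact hF y hy)
    (restrictScalars K M⟮ϖ⟯)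
    (fun x hx => exists_val_eq_pow_of_mem_adjoin hℓ (fun x hx => (hM x hx).1) hπ hϖ hx)
  have hMM' : M ≤ M' := fun x hx => hM' ((M⟮ϖ⟯).algebraMap_mem ⟨x, hx⟩)
  have hϖM : ϖ ∈ M' := hM' (mem_adjoin_simple_self M ϖ)
  refine ⟨M, M', hMM', hval, hMroot, hroot, fun z hz => ?_⟩
  by_cases hz0 : z = 0
  · rw [hz0]; exact zero_mem _
  obtain ⟨y, hy⟩ := (hM _ hz).1
  have hv0 : extendedValuation K Ω (z ^ ℓ) ≠ 0 :=
    (Valuation.ne_zero_iff _).2 (pow_ne_zero _ hz0)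
  have hmem : Units.mk0 _ hv0 ∈ Subgroup.zpowers γ := by
    rw [hγ, Valuation.IsRankOneDiscrete.generator_zpowers_eq_valueGroup,
      mem_valueGroup_iff_exists]
    exact ⟨y, hy⟩
  obtain ⟨m, hm⟩ := Subgroup.mem_zpowers_iff.1 hmem
  have hm' : (γ : ℝ≥0) ^ m = extendedValuation K Ω z ^ ℓ := by
    have := congrArg Units.val hm
    rw [Units.val_zpow_eq_zpow_val, Units.val_mk0, map_pow] at this
    exact this
  have hvϖ : extendedValuation K Ω ϖ ^ ℓ = γ := by
    rw [← map_pow, hϖ, extendedValuation_algebraMap, hπ]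
  have hϖ0 : ϖ ≠ 0 := by
    rintro rfl
    rw [map_zero, zero_pow hℓ] at hvϖ
    exact γ.ne_zero hvϖ.symm
  -- `m` is chosen with `v z ^ ℓ = γ ^ m = v (ϖ ^ m) ^ ℓ`.
  have hunit : extendedValuation K Ω (z / ϖ ^ m) = 1 := by
    have h1 : extendedValuation K Ω (z / ϖ ^ m) ^ ℓ = 1 := by
      rw [map_div₀, map_zpow₀, div_pow, ← hm', ← zpow_natCast, ← zpow_mul, mul_comm, zpow_mul,
        zpow_natCast, hvϖ, div_self (zpow_ne_zero _ γ.ne_zero)]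
    exact (pow_eq_one_iff_of_nonneg zero_le hℓ).1 h1
  have h2 : z / ϖ ^ m ∈ M' := by
    refine hroot _ hunit ?_
    rw [div_pow]
    exact div_mem (hMM' hz) (pow_mem (zpow_mem hϖM m) ℓ)
  have h3 := mul_mem h2 (zpow_mem hϖM m)
  rwa [div_mul_cancel₀ _ (zpow_ne_zero _ hϖ0)] at h3

end Ramification

/-! ### Trapping the tower in a root-closed field. -/

section Tower

variable {K : Type*} [Field K] {Ω : Type*} [Field Ω] [Algebra K Ω] {ℓ : ℕ} {c a : K}

theorem limitField_le {M : IntermediateField K Ω}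
    (h : ∀ n z, (powSub ℓ (algebraMap K Ω c))^[n] z = algebraMap K Ω a → z ∈ M) :
    limitField K Ω ℓ c a ≤ M :=
  iSup_le fun n => adjoin_le_iff.2 fun z hz => h n z hz

theorem mem_limitField {n : ℕ} {z : Ω}
    (h : (powSub ℓ (algebraMap K Ω c))^[n] z = algebraMap K Ω a) : z ∈ limitField K Ω ℓ c a :=
  le_iSup (levelField K Ω ℓ c a) n (subset_adjoin K _ h)

/-- If all points of the backward orbit are zero or units, the tower lies in every field that is
closed under `ℓ`-th roots of units. -/
theorem limitField_le_of_rootClosed {v : Valuation Ω ℝ≥0} {M : IntermediateField K Ω}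
    (hM : ∀ z, v z = 1 → z ^ ℓ ∈ M → z ∈ M)
    (h : ∀ n z, (powSub ℓ (algebraMap K Ω c))^[n] z = algebraMap K Ω a → z = 0 ∨ v z = 1) :
    limitField K Ω ℓ c a ≤ M := by
  refine limitField_le fun n => ?_
  induction n with
  | zero => rintro z rfl; exact M.algebraMap_mem a
  | succ n ih =>
    intro z hz
    rcases h (n + 1) z hz with rfl | hz1
    · exact zero_mem M
    · refine hM z hz1 ?_
      rw [← powSub_add ℓ (algebraMap K Ω c)]
      exact add_mem (ih _ hz) (M.algebraMap_mem c)

/-- If the residue class of `0` is not periodic, every branch of the backward orbit contains at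
most one nonunit. -/
theorem limitField_le_of_rootClosed_pair {v : Valuation Ω ℝ≥0} (hℓ : ℓ ≠ 0)
    (hc : v (algebraMap K Ω c) ≤ 1) (ha : v (algebraMap K Ω a) ≤ 1)
    (hnper : ∀ n, 0 < n → ¬ v ((powSub ℓ (algebraMap K Ω c))^[n] 0) < 1)
    {M M' : IntermediateField K Ω} (hle : M ≤ M') (hM : ∀ z, v z = 1 → z ^ ℓ ∈ M → z ∈ M)
    (hM' : ∀ z, v z = 1 → z ^ ℓ ∈ M' → z ∈ M') (hroot : ∀ z, z ^ ℓ ∈ M → z ∈ M') :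
    limitField K Ω ℓ c a ≤ M' := by
  set g := powSub ℓ (algebraMap K Ω c) with hg
  -- A point stays in `M` until its branch meets a nonunit; the second alternative records that
  -- meeting.
  suffices H : ∀ n z, g^[n] z = algebraMap K Ω a → z ∈ M ∨ (z ∈ M' ∧ ∃ i, v (g^[i] z) < 1) from
    limitField_le fun n z hz => (H n z hz).elim (fun h => hle h) And.left
  intro n
  induction n with
  | zero => rintro z rfl; exact .inl (M.algebraMap_mem a)
  | succ n ih =>
    intro z hz
    have hz1 : v z ≤ 1 := val_le_one_of_iterate hℓ hc (n + 1) (by rw [← hg, hz]; exact ha)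
    have hpow : ∀ {F : IntermediateField K Ω}, g z ∈ F → z ^ ℓ ∈ F := fun {F} h => by
      rw [← powSub_add ℓ (algebraMap K Ω c)]
      exact add_mem h (F.algebraMap_mem c)
    rcases ih (g z) hz with h | ⟨h, i, hi⟩
    · rcases hz1.lt_or_eq with hlt | heq
      · exact .inr ⟨hroot z (hpow h), 0, hlt⟩
      · exact .inl (hM z heq (hpow h))
    · refine .inr ⟨hM' z (hz1.lt_or_eq.resolve_left fun hlt => ?_) (hpow h), i + 1, hi⟩
      refine hnper (i + 1) i.succ_pos ?_
      -- A second nonunit `z` would force `g^(i+1) 0 ≡ g^(i+1) z ≡ 0`.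
      have h1 := (val_iterate_sub_le (ℓ := ℓ) hc (by simp) hz1 (i + 1) (x := 0)).trans_lt
        (by rwa [zero_sub, v.map_neg])
      have h2 := v.map_add (g^[i + 1] 0 - g^[i + 1] z) (g^[i + 1] z)
      rw [sub_add_cancel] at h2
      exact h2.trans_lt (max_lt h1 hi)

theorem algebraMap_iterate_zero (n : ℕ) :
    algebraMap K Ω ((powSub ℓ c)^[n] 0) = (powSub ℓ (algebraMap K Ω c))^[n] 0 := by
  rw [map_powSub_iterate, map_zero]

theorem inSingleCycle_algebraMap_iff :
    InSingleCycle (powSub ℓ (algebraMap K Ω c)) 0 (algebraMap K Ω a) ↔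
      InSingleCycle (powSub ℓ c) 0 a := by
  simp only [InSingleCycle, Function.mem_periodicPts, Function.IsPeriodicPt, Function.IsFixedPt,
    forwardOrbit, Set.mem_range, ← algebraMap_iterate_zero, map_eq_zero,
    (algebraMap K Ω).injective.eq_iff]

end Tower

/-! ### Residue dynamics in terms of valuations. -/

section Residues

variable {K : Type*} [NontriviallyNormedField K] [IsUltrametricDist K] {ℓ : ℕ} {c a : K}

theorem residue_eq_iff {E : Type*} [Field E] {v : Valuation E ℝ≥0} {x y : E} (hx : v x ≤ 1)
    (hy : v y ≤ 1) : IsLocalRing.residue v.valuationSubring ⟨x, hx⟩ =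
      IsLocalRing.residue v.valuationSubring ⟨y, hy⟩ ↔ v (x - y) < 1 := by
  have hxy : v (x - y) ≤ 1 := (v.map_sub _ _).trans (max_le hx hy)
  rw [← sub_eq_zero, ← map_sub, IsLocalRing.residue_eq_zero_iff, IsLocalRing.mem_maximalIdeal,
    mem_nonunits_iff, isUnit_valuationSubring_iff]
  exact ⟨fun h => hxy.lt_of_ne h, fun h => h.ne⟩

theorem iterate_residue_zero (hc : baseValuation K c ≤ 1) (n : ℕ) :
    (powSub ℓ (IsLocalRing.residue (integers K) ⟨c, hc⟩))^[n] 0 =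
      IsLocalRing.residue (integers K)
        ⟨(powSub ℓ c)^[n] 0, val_zero_iterate_le_one hc n⟩ := by
  have h := map_powSub_iterate (IsLocalRing.residue (integers K)) ℓ ⟨c, hc⟩ 0 n
  rw [map_zero] at h
  rw [← h]
  congr 1
  apply Subtype.ext
  exact map_powSub_iterate (integers K).subtype ℓ ⟨c, hc⟩ 0 n

variable [CompleteSpace K] {Ω : Type*} [Field Ω] [Algebra K Ω] [Algebra.IsAlgebraic K Ω]

theorem iterate_residue_zero_eq_iff (hc : baseValuation K c ≤ 1) (ha : baseValuation K a ≤ 1)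
    (n : ℕ) : (powSub ℓ (IsLocalRing.residue (integers K) ⟨c, hc⟩))^[n] 0 =
      IsLocalRing.residue (integers K) ⟨a, ha⟩ ↔
      extendedValuation K Ω
        (algebraMap K Ω a - (powSub ℓ (algebraMap K Ω c))^[n] 0) < 1 := by
  rw [iterate_residue_zero, residue_eq_iff, ← algebraMap_iterate_zero, ← map_sub,
    extendedValuation_algebraMap, Valuation.map_sub_swap]

theorem iterate_residue_zero_eq_zero_iff (hc : baseValuation K c ≤ 1) (n : ℕ) :
    (powSub ℓ (IsLocalRing.residue (integers K) ⟨c, hc⟩))^[n] 0 = 0 ↔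
      extendedValuation K Ω ((powSub ℓ (algebraMap K Ω c))^[n] 0) < 1 := by
  have h := iterate_residue_zero_eq_iff (Ω := Ω) (ℓ := ℓ) hc (a := 0) (by simp) n
  rw [map_zero (algebraMap K Ω), zero_sub, Valuation.map_neg] at h
  rw [← h]
  exact Eq.congr_right (map_zero (IsLocalRing.residue (integers K))).symm

theorem extendedValuation_natCast_eq_one (hℓ : ¬ ringChar (residueField K) ∣ ℓ) :
    extendedValuation K Ω (ℓ : Ω) = 1 := by
  have h1 : (ℓ : residueField K) ≠ 0 := fun h => hℓ ((ringChar.spec _ ℓ).1 h)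
  rw [← map_natCast (IsLocalRing.residue (integers K)),
    IsLocalRing.residue_ne_zero_iff_isUnit, isUnit_valuationSubring_iff] at h1
  rw [← map_natCast (algebraMap K Ω), extendedValuation_algebraMap]
  exact h1

end Residues

end Arboreal

/-! ### The four cases. -/

theorem theorem7p3
    -- `K` is a field complete with respect to a discrete valuation, `Ω` an algebraic closure
    {K : Type*} [NontriviallyNormedField K] [IsUltrametricDist K] [CompleteSpace K]
    [(Arboreal.baseValuation K).IsRankOneDiscrete]
    {Ω : Type*} [Field Ω] [Algebra K Ω] [IsAlgClosure K Ω]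
    -- the tame case: `ℓ ≥ 2` is not divisible by the residue characteristic (which may be `0`)
    (ℓ : ℕ) (hℓ : 2 ≤ ℓ) (htame : ¬ ringChar (Arboreal.residueField K) ∣ ℓ)
    -- `c` and `a` have nonnegative (additive) valuation
    (c a : K) (hc0 : c ≠ 0) (hc : Arboreal.baseValuation K c ≤ 1)
    (ha : Arboreal.baseValuation K a ≤ 1) :
    -- `f` on `K`, and its reduction on the residue field, with the reduction of `a`
    let f : K → K := Arboreal.powSub ℓ c
    let fbar : Arboreal.residueField K → Arboreal.residueField K :=
      Arboreal.powSub ℓ (IsLocalRing.residue (Arboreal.integers K) ⟨c, hc⟩)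
    let abar : Arboreal.residueField K := IsLocalRing.residue (Arboreal.integers K) ⟨a, ha⟩
    let Kinf : IntermediateField K Ω := Arboreal.limitField K Ω ℓ c a
    -- (a)
    (abar ∉ Arboreal.forwardOrbit fbar 0 → Arboreal.IsUnramified K Kinf) ∧
    -- (b)
    (Arboreal.IsStrictlyPreperiodic fbar 0 → Arboreal.ramificationIndex K Kinf ∣ ℓ) ∧
    -- (c)
    (Arboreal.InSingleCycle f 0 a → Arboreal.IsUnramified K Kinf) ∧
    -- (d)
    (Arboreal.InSingleCycle fbar 0 abar → ¬ Arboreal.InSingleCycle f 0 a →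
      Arboreal.IsInfinitelyRamified K Kinf) := by
  intro f fbar abar Kinf
  have : IsAlgClosed Ω := IsAlgClosure.isAlgClosed K
  have hℓ0 : ℓ ≠ 0 := by omega
  have hℓ1 : Arboreal.extendedValuation K Ω (ℓ : Ω) = 1 :=
    Arboreal.extendedValuation_natCast_eq_one htame
  have hcΩ : Arboreal.extendedValuation K Ω (algebraMap K Ω c) ≤ 1 := by
    rwa [Arboreal.extendedValuation_algebraMap]
  have haΩ : Arboreal.extendedValuation K Ω (algebraMap K Ω a) ≤ 1 := by
    rwa [Arboreal.extendedValuation_algebraMap]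
  have unramified_of_val : (∀ n z,
      (Arboreal.powSub ℓ (algebraMap K Ω c))^[n] z = algebraMap K Ω a →
        Arboreal.extendedValuation K Ω z < 1 → z = 0) → Arboreal.IsUnramified K Kinf := by
    intro h
    obtain ⟨M, hM, hMroot⟩ := Arboreal.exists_unramified_rootClosed (K := K) hℓ1
    refine Arboreal.isUnramified_of_forall _ fun x hx => hM x ?_
    refine Arboreal.limitField_le_of_rootClosed hMroot (fun n z hz => ?_) hx
    have hz1 : Arboreal.extendedValuation K Ω z ≤ 1 :=
      Arboreal.val_le_one_of_iterate hℓ0 hcΩ n (by rw [hz]; exact haΩ)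
    exact hz1.lt_or_eq.imp (h n z hz) id
  refine ⟨fun h => ?_, fun h => ?_, fun h => ?_, fun h h' => ?_⟩
  · refine unramified_of_val fun n z hz hz1 => (h ⟨n, ?_⟩).elim
    refine (Arboreal.iterate_residue_zero_eq_iff (Ω := Ω) hc ha n).2 ?_
    rw [← hz]
    exact (Arboreal.val_iterate_sub_le (ℓ := ℓ) hcΩ hz1.le (by simp) n).trans_lt (by simpa)
  -- Infinite index is encoded as `0`, so dividing `ℓ ≠ 0` includes finiteness.
  · obtain ⟨M, M', hle, hval, hM, hM', hroot⟩ := Arboreal.exists_rootClosed_pair (K := K) hℓ0 hℓ1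
    refine Arboreal.ramificationIndex_dvd hℓ0 _ fun x hx => hval x ?_
    refine Arboreal.limitField_le_of_rootClosed_pair hℓ0 hcΩ haΩ (fun n hn hn1 => h.1 ?_)
      hle hM hM' hroot hx
    exact ⟨n, hn, (Arboreal.iterate_residue_zero_eq_zero_iff hc n).2 hn1⟩
  · obtain ⟨hper, j, hj⟩ := (Arboreal.inSingleCycle_algebraMap_iff (Ω := Ω)).2 h
    exact unramified_of_val fun n z hz hz1 =>
      Arboreal.eq_zero_of_iterate_mem_cycle hℓ hℓ1 hcΩ hper hz1 (hz.trans hj.symm)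
  · obtain ⟨⟨N, hN, hper⟩, n, hn⟩ := h
    obtain ⟨τ, hτ, hy⟩ := Arboreal.exists_backward_val_bound hℓ hℓ1 hcΩ
      ⟨N, hN, (Arboreal.iterate_residue_zero_eq_zero_iff hc N).1 hper⟩
      ⟨n, (Arboreal.iterate_residue_zero_eq_iff hc ha n).1 hn⟩
      (fun h => h' (Arboreal.inSingleCycle_algebraMap_iff.1 h))
    refine Arboreal.isInfinitelyRamified_of_roots hℓ _ hτ fun m => ?_
    obtain ⟨y, k, h1, h2, h3⟩ := hy m
    exact ⟨y, Arboreal.mem_limitField h1, h2, h3⟩
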